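/- For $s\ge 1$ let $\gamma^{(s)}(\mathbb{R})$ be the Gevrey class of order $s$: the set of $f\in C^\infty(\mathbb{R};\mathbb{C})$ such that for every compact $K\subset\mathbb{R}$ there are $C,h>0$ with $|f^{(k)}(x)|\le C\,h^{-k}(k!)^s$ for all $x\in K$ and $k\in\mathbb{N}$. For complex-valued functions $u(t,x)$ consider the Cauchy problem $$\partial_t^2u+i\,\partial_xu=0,\qquad u(0,x)=\varphi_0(x),\quad \partial_tu(0,x)=\varphi_1(x).\tag{1}$$ Given a class $A$ of functions on $\mathbb{R}$, problem (1) is called locally solvable in $A$ at the origin if for all $\varphi_0,\varphi_1\in A$ there are a neighborhood $U$ of the origin of $\mathbb{R}^2$ (possibly depending on $\varphi_0,\varphi_1$) and a function $u\in C^\infty(U)$ such that $\partial_t^2u+i\,\partial_xu=0$ in $U$ and $u(0,x)=\varphi_0(x)$, $\partial_tu(0,x)=\varphi_1(x)$ whenever $(0,x)\in U$. **Theorem.** If $s>2$, then the Cauchy problem (1) is not locally solvable in $\gamma^{(s)}(\mathbb{R})$ at the origin. In particular, it is not $C^\infty$-solvable: it is not locally solvable in $C^\infty(\mathbb{R})$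 at the origin, and for every $T>0$ there are $\varphi_0,\varphi_1\in C^\infty(\mathbb{R})$ for which (1) has no solution $u\in C^\infty([0,T]\times\mathbb{R})$ on $[0,T]\times\mathbb{R}$. -/

import Mathlib

open scoped ContDiff

/-- The class `C^∞(ℝ)` of smooth complex-valued functions on the line. -/
def smoothClass : Set (ℝ → ℂ) :=
  {f | ContDiff ℝ ∞ f}

/-- The Gevrey class `γ^{(s)}(ℝ)`: smooth functions `f` such that on every compact set `K`
there are `C, h > 0` with `|f^{(k)}(x)| ≤ C h^{-k} (k!)^s` for all `x ∈ K` and all `k`. -/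
def gevreyClass (s : ℝ) : Set (ℝ → ℂ) :=
  {f | ContDiff ℝ ∞ f ∧
    ∀ K : Set ℝ, IsCompact K →
      ∃ C h : ℝ, 0 < C ∧ 0 < h ∧
        ∀ x ∈ K, ∀ k : ℕ, ‖iteratedDeriv k f x‖ ≤ C * h⁻¹ ^ k * (k.factorial : ℝ) ^ s}

/-- The operator `P = ∂_t² + i ∂_x` acting on functions of `(t, x)`. -/
noncomputable def modelOperator (u : ℝ × ℝ → ℂ) (p : ℝ × ℝ) : ℂ :=
  iteratedDeriv 2 (fun t : ℝ => u (t, p.2)) p.1 +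
    Complex.I * deriv (fun x : ℝ => u (p.1, x)) p.2

/-- Local solvability at the origin, for initial data in the class `A`, of the Cauchy problem
`P u = 0`, `u(0, x) = φ₀(x)`, `∂_t u(0, x) = φ₁(x)` with data on the line `t = 0`: for all
`φ₀, φ₁ ∈ A` there are an open neighborhood `U` of the origin of `ℝ²`, which may depend on the
data, and a function `u ∈ C^∞(U)` which solves the problem in `U`. -/
def LocallySolvableAtOrigin (P : (ℝ × ℝ → ℂ) → ℝ × ℝ → ℂ) (A : Set (ℝ → ℂ)) : Prop :=
  ∀ φ₀ ∈ A, ∀ φ₁ ∈ A,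
    ∃ U : Set (ℝ × ℝ), IsOpen U ∧ (0, 0) ∈ U ∧
      ∃ u : ℝ × ℝ → ℂ, ContDiffOn ℝ ∞ u U ∧
        (∀ p ∈ U, P u p = 0) ∧
        ∀ x : ℝ, (0, x) ∈ U →
          u (0, x) = φ₀ x ∧ deriv (fun t : ℝ => u (t, x)) 0 = φ₁ x

/-- Solvability in `C^∞` of the Cauchy problem `∂_t² u + i ∂_x u = 0`, `u(0, x) = φ₀(x)`,
`∂_t u(0, x) = φ₁(x)` on the closed strip `[0, T] × ℝ`: for all `φ₀, φ₁ ∈ C^∞(ℝ)` there is a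
solution which is smooth up to the boundary. The derivatives in `t` are one-sided at `t = 0`
and at `t = T`. -/
def SmoothlySolvableOnStrip (T : ℝ) : Prop :=
  ∀ φ₀ ∈ smoothClass, ∀ φ₁ ∈ smoothClass,
    ∃ u : ℝ × ℝ → ℂ, ContDiffOn ℝ ∞ u (Set.Icc 0 T ×ˢ Set.univ) ∧
      (∀ t ∈ Set.Icc 0 T, ∀ x : ℝ,
        iteratedDerivWithin 2 (fun τ : ℝ => u (τ, x)) (Set.Icc 0 T) t +
          Complex.I * deriv (fun y : ℝ => u (t, y)) x = 0) ∧
      ∀ x : ℝ, u (0, x) = φ₀ x ∧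
        derivWithin (fun τ : ℝ => u (τ, x)) (Set.Icc 0 T) 0 = φ₁ x

open Set Filter Topology MeasureTheory
open scoped Nat

/-! The equation sends the mode `e^{iξx}` to `cosh(√ξ t) e^{iξx}`. With frequencies `ξ_j = j ^ s`,
the amplitudes `e^{-j}` give a function of Gevrey order `s`, while the amplification at time `T` is
about `e^{T j^{s/2}}`. For `s > 2` this beats `e^{-j}` at every `T > 0`. The data are `φ₀ =
exponentialSeries s 0` and `φ₁ = 0`.

A local solution need not be a sum of modes, so the growth is detected by duality. Let `g = χ
e^{-iξ_m x}` with `χ` supported inside the interval, and put `G(t) = ∫ u(t,x) g(x) dx`. Integration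
by parts turns two `t`-derivatives of `G` into one factor `i ∂_x` on `g`. If `χ` satisfies a Gevrey
bound of order 2, the derivative of order `2k` grows at most like `a^k (k!)^2`, which is comparable
to `(2k)!`. Hence for small `T` the Taylor series of `G` at `0` converges to `G(T)`
(`IsRectangleSolution.norm_sub_taylor_le`, `tendsto_taylor_remainder`).

The Taylor coefficients depend on the data only. If moreover the Fourier transform of `χ` is
nonnegative, all frequencies contribute with nonnegative real part, and the frequency `ξ_m` alone
gives `e^{-m} cosh(T m^{s/2}) ∫ χ` as a lower bound for the real part of the sum
(`le_re_integral_exponentialSeries_mul`). But `|G(T)|` is bounded independently of `m`, because the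
oscillating factor has modulus one. Letting `m → ∞` gives the contradiction
(`IsRectangleSolution.exp_neg_mul_cosh_le`, `not_isRectangleSolution`). -/

/-! ### Global derivative bounds of Gevrey order 2. -/

/-- The derivatives of `f` are bounded by `C a ^ k (k!) ^ 2`, uniformly on the line. -/
def FactorialSqBound (a : ℝ) (f : ℝ → ℂ) : Prop :=
  ∃ C : ℝ, 0 ≤ C ∧ ∀ (k : ℕ) (x : ℝ), ‖iteratedDeriv k f x‖ ≤ C * a ^ k * (k ! : ℝ) ^ 2

theorem choose_mul_factorial_sq_le {n i : ℕ} (hi : i ≤ n) :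
    (n.choose i : ℝ) * ((i ! : ℝ) ^ 2 * ((n - i)! : ℝ) ^ 2) ≤ (n ! : ℝ) ^ 2 := by
  have h1 : (n.choose i : ℝ) * (i ! : ℝ) * ((n - i)! : ℝ) = (n ! : ℝ) := by
    exact_mod_cast Nat.choose_mul_factorial_mul_factorial hi
  have h2 : (i ! : ℝ) * ((n - i)! : ℝ) ≤ (n ! : ℝ) := by
    exact_mod_cast Nat.le_of_dvd (Nat.factorial_pos n) (Nat.factorial_mul_factorial_dvd_factorial hi)
  calc _ = ((n.choose i : ℝ) * (i ! : ℝ) * ((n - i)! : ℝ)) * ((i ! : ℝ) * ((n - i)! : ℝ)) := by ring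
    _ ≤ (n ! : ℝ) * (n ! : ℝ) := by rw [h1]; gcongr
    _ = _ := by ring

/-- By Leibniz's rule each term is at most `C D a^n (n!)^2`. The `n + 1 ≤ 2 ^ n` terms account for
the doubling of `a`. -/
theorem FactorialSqBound.mul {a : ℝ} {f g : ℝ → ℂ} (ha : 0 ≤ a) (hf : ContDiff ℝ ∞ f)
    (hg : ContDiff ℝ ∞ g) (hfb : FactorialSqBound a f) (hgb : FactorialSqBound a g) :
    FactorialSqBound (2 * a) (fun x => f x * g x) := by
  obtain ⟨C, hC, hfC⟩ := hfb
  obtain ⟨D, hD, hgD⟩ := hgb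
  refine ⟨C * D, by positivity, fun n x => ?_⟩
  have h := norm_iteratedFDeriv_mul_le (𝕜 := ℝ) hf hg x (n := n) (by exact_mod_cast le_top)
  simp only [norm_iteratedFDeriv_eq_norm_iteratedDeriv] at h
  refine h.trans ?_
  calc _ ≤ ∑ i ∈ Finset.range (n + 1), C * D * a ^ n * (n ! : ℝ) ^ 2 := by
        refine Finset.sum_le_sum fun i hi => ?_
        have hi' : i ≤ n := Nat.lt_succ_iff.mp (Finset.mem_range.mp hi)
        calc _ ≤ (n.choose i : ℝ) * (C * a ^ i * (i ! : ℝ) ^ 2) *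
              (D * a ^ (n - i) * ((n - i)! : ℝ) ^ 2) := by
              gcongr
              · exact hfC i x
              · exact hgD (n - i) x
          _ = C * D * (a ^ i * a ^ (n - i)) *
              ((n.choose i : ℝ) * ((i ! : ℝ) ^ 2 * ((n - i)! : ℝ) ^ 2)) := by ring
          _ ≤ _ := by
              rw [← pow_add, Nat.add_sub_cancel' hi']
              exact mul_le_mul_of_nonneg_left (choose_mul_factorial_sq_le hi') (by positivity)
    _ = ((n + 1 : ℕ) : ℝ) * (C * D * a ^ n * (n ! : ℝ) ^ 2) := by simp
    _ ≤ (2 ^ n : ℝ) * (C * D * a ^ n * (n ! : ℝ) ^ 2) := by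
        gcongr
        exact_mod_cast Nat.lt_two_pow_self (n := n)
    _ = _ := by rw [mul_pow]; ring

theorem FactorialSqBound.comp_const_add {a : ℝ} {f : ℝ → ℂ} (h : FactorialSqBound a f) (c : ℝ) :
    FactorialSqBound a (fun x => f (c + x)) := by
  obtain ⟨C, hC, hf⟩ := h
  refine ⟨C, hC, fun k x => ?_⟩
  rw [iteratedDeriv_comp_const_add]
  exact hf k _

theorem FactorialSqBound.comp_const_sub {a : ℝ} {f : ℝ → ℂ} (h : FactorialSqBound a f) (c : ℝ) :
    FactorialSqBound a (fun x => f (c - x)) := by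
  obtain ⟨C, hC, hf⟩ := h
  refine ⟨C, hC, fun k x => ?_⟩
  rw [iteratedDeriv_comp_const_sub]
  simpa [norm_smul] using hf k _

theorem hasDerivAt_cexp_mul_ofReal (c : ℂ) (x : ℝ) :
    HasDerivAt (fun y : ℝ => Complex.exp (c * y)) (c * Complex.exp (c * x)) x := by
  have h : HasDerivAt (fun z : ℂ => Complex.exp (c * z)) (Complex.exp (c * x) * (c * 1)) x :=
    ((hasDerivAt_id (x : ℂ)).const_mul c).cexp
  convert h.comp_ofReal using 1
  ring

theorem iteratedDeriv_cexp_mul_ofReal (c : ℂ) (k : ℕ) :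
    iteratedDeriv k (fun x : ℝ => Complex.exp (c * x)) =
      fun x : ℝ => c ^ k * Complex.exp (c * x) := by
  induction k with
  | zero => simp
  | succ k ih =>
    rw [iteratedDeriv_succ, ih]
    ext x
    rw [((hasDerivAt_cexp_mul_ofReal c x).const_mul (c ^ k)).deriv]
    ring

theorem contDiff_cexp_mul_ofReal (c : ℂ) : ContDiff ℝ ∞ (fun x : ℝ => Complex.exp (c * x)) :=
  (contDiff_const.mul Complex.ofRealCLM.contDiff).cexp

theorem norm_cexp_I_mul_ofReal (ξ x : ℝ) : ‖Complex.exp (Complex.I * ξ * x)‖ = 1 := by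
  rw [mul_assoc, mul_comm, ← Complex.ofReal_mul]
  exact Complex.norm_exp_ofReal_mul_I _

/-- The rate `a` does not depend on the frequency: only the constant `e^{|ξ|/a}` does. This is what
allows one time `T` to serve all frequencies. -/
theorem factorialSqBound_cexp {a : ℝ} (ha : 0 < a) (ξ : ℝ) :
    FactorialSqBound a (fun x : ℝ => Complex.exp (Complex.I * ξ * x)) := by
  refine ⟨Real.exp (|ξ| / a), (Real.exp_pos _).le, fun k x => ?_⟩
  rw [iteratedDeriv_cexp_mul_ofReal]
  simp only [norm_mul, norm_pow, norm_cexp_I_mul_ofReal, Complex.norm_I, Complex.norm_real,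
    Real.norm_eq_abs, one_mul, mul_one]
  have h := Real.pow_div_factorial_le_exp (|ξ| / a) (by positivity) k
  have hk : (1 : ℝ) ≤ (k ! : ℝ) := by exact_mod_cast Nat.factorial_pos k
  rw [div_le_iff₀ (by positivity), div_pow, div_le_iff₀ (by positivity)] at h
  calc |ξ| ^ k ≤ Real.exp (|ξ| / a) * (k ! : ℝ) * a ^ k := h
    _ = Real.exp (|ξ| / a) * a ^ k * ((k ! : ℝ) * 1) := by ring
    _ ≤ Real.exp (|ξ| / a) * a ^ k * ((k ! : ℝ) * (k ! : ℝ)) := by gcongr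
    _ = _ := by ring

/-! ### The Gevrey bound for `e^{-1/x}`. -/

theorem iteratedDeriv_cexp_neg_inv_ofReal (k : ℕ) {x : ℝ} (hx : 0 < x) :
    iteratedDeriv k (fun y : ℝ => Complex.exp (-(y : ℂ)⁻¹)) x =
      iteratedDeriv k (fun z : ℂ => Complex.exp (-z⁻¹)) x := by
  induction k generalizing x with
  | zero => simp
  | succ k ih =>
    have hx0 : (x : ℂ) ≠ 0 := by exact_mod_cast hx.ne'
    have hd : AnalyticAt ℂ (fun z : ℂ => Complex.exp (-z⁻¹)) x := (analyticAt_inv hx0).neg.cexp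
    have hdd : DifferentiableAt ℂ (iteratedDeriv k (fun z : ℂ => Complex.exp (-z⁻¹))) x := by
      rw [iteratedDeriv_eq_iterate]
      exact (hd.iterated_deriv k).differentiableAt
    rw [iteratedDeriv_succ, iteratedDeriv_succ, ← hdd.hasDerivAt.comp_ofReal.deriv]
    apply EventuallyEq.deriv_eq
    filter_upwards [lt_mem_nhds hx] with y hy using ih hy

/-- Cauchy's estimate on the circle of radius `x/2` gives `k! (2/x)^k e^{-2/(9x)}`, and `y^k ≤ k!
e^y` with `y = 2/(9x)` absorbs the power of `1/x`. -/
theorem norm_iteratedDeriv_cexp_neg_inv_le (k : ℕ) {x : ℝ} (hx : 0 < x) :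
    ‖iteratedDeriv k (fun z : ℂ => Complex.exp (-z⁻¹)) x‖ ≤ 9 ^ k * (k ! : ℝ) ^ 2 := by
  have hre : ∀ z ∈ Metric.closedBall (x : ℂ) (x / 2), x / 2 ≤ z.re := fun z hz => by
    have h1 := (Complex.abs_re_le_norm (z - x)).trans (by simpa [dist_eq_norm] using hz)
    simp only [Complex.sub_re, Complex.ofReal_re] at h1
    linarith [(abs_le.mp h1).1]
  have hne : ∀ z ∈ Metric.closedBall (x : ℂ) (x / 2), z ≠ 0 := fun z hz h0 => by
    have := hre z hz
    rw [h0, Complex.zero_re] at this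
    linarith
  have hdc : DiffContOnCl ℂ (fun z : ℂ => Complex.exp (-z⁻¹)) (Metric.ball x (x / 2)) := by
    apply DifferentiableOn.diffContOnCl
    rw [closure_ball _ (by positivity)]
    intro z hz
    exact ((differentiableAt_inv (hne z hz)).neg.cexp).differentiableWithinAt
  -- On the circle `Re z ≥ x/2` and `|z| ≤ 3x/2`, so `Re (1/z) = Re z / |z|^2 ≥ 2/(9x)`.
  have hb : ∀ z ∈ Metric.sphere (x : ℂ) (x / 2),
      ‖Complex.exp (-z⁻¹)‖ ≤ Real.exp (-(2 / (9 * x))) := fun z hz => by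
    have hz' := Metric.sphere_subset_closedBall hz
    have h1 := hre z hz'
    have h0 : 0 < ‖z‖ := norm_pos_iff.mpr (hne z hz')
    have h2 : ‖z‖ ≤ 3 * x / 2 := by
      have : ‖z‖ ≤ ‖z - x‖ + ‖(x : ℂ)‖ := by simpa using norm_add_le (z - x) (x : ℂ)
      have h3 : ‖z - x‖ = x / 2 := by simpa [dist_eq_norm] using hz
      rw [h3, Complex.norm_real, Real.norm_of_nonneg hx.le] at this
      linarith
    rw [Complex.norm_exp, Real.exp_le_exp, Complex.neg_re, Complex.inv_re, neg_le_neg_iff,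
      Complex.normSq_eq_norm_sq, div_le_div_iff₀ (by positivity) (by positivity)]
    nlinarith [mul_le_mul h2 h2 h0.le (by positivity)]
  refine (Complex.norm_iteratedDeriv_le_of_forall_mem_sphere_norm_le k (by positivity) hdc
    hb).trans ?_
  have h := Real.pow_div_factorial_le_exp (2 / (9 * x)) (by positivity) k
  rw [div_le_iff₀ (by positivity)] at h
  rw [Real.exp_neg, div_le_iff₀ (by positivity), mul_inv_le_iff₀ (Real.exp_pos _)]
  calc (k ! : ℝ) = (k ! : ℝ) * ((9 * (x / 2)) ^ k * (2 / (9 * x)) ^ k) := by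
        rw [← mul_pow, show 9 * (x / 2) * (2 / (9 * x)) = 1 by field_simp, one_pow, mul_one]
    _ ≤ (k ! : ℝ) * ((9 * (x / 2)) ^ k * (Real.exp (2 / (9 * x)) * (k ! : ℝ))) := by gcongr
    _ = _ := by rw [mul_pow]; ring

theorem contDiff_ofReal_expNegInvGlue : ContDiff ℝ ∞ (fun x : ℝ => (expNegInvGlue x : ℂ)) :=
  Complex.ofRealCLM.contDiff.comp expNegInvGlue.contDiff

theorem factorialSqBound_expNegInvGlue :
    FactorialSqBound 9 (fun x : ℝ => (expNegInvGlue x : ℂ)) := by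
  refine ⟨1, zero_le_one, fun k => ?_⟩
  have hcont : Continuous (iteratedDeriv k (fun x : ℝ => (expNegInvGlue x : ℂ))) :=
    contDiff_ofReal_expNegInvGlue.continuous_iteratedDeriv k (by exact_mod_cast le_top)
  -- The bound is a closed condition, so it suffices to check it on the dense set `x ≠ 0`.
  have hclosed : IsClosed {x | ‖iteratedDeriv k (fun x : ℝ => (expNegInvGlue x : ℂ)) x‖ ≤
      1 * 9 ^ k * (k ! : ℝ) ^ 2} := isClosed_le hcont.norm continuous_const
  have hsub : ({0}ᶜ : Set ℝ) ⊆ {x | ‖iteratedDeriv k (fun x : ℝ => (expNegInvGlue x : ℂ)) x‖ ≤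
      1 * 9 ^ k * (k ! : ℝ) ^ 2} := fun x hx => by
    rcases lt_or_gt_of_ne hx with h | h
    · have he : (fun x : ℝ => (expNegInvGlue x : ℂ)) =ᶠ[𝓝 x] fun _ => (0 : ℂ) := by
        filter_upwards [gt_mem_nhds h] with y hy
        rw [expNegInvGlue.zero_of_nonpos hy.le, Complex.ofReal_zero]
      have h0 : iteratedDeriv k (fun _ : ℝ => (0 : ℂ)) x = 0 := iteratedDeriv_const_zero
      rw [mem_ofPred_eq, he.iteratedDeriv_eq, h0, norm_zero]
      positivity
    · have he : (fun x : ℝ => (expNegInvGlue x : ℂ)) =ᶠ[𝓝 x]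
          fun y : ℝ => Complex.exp (-(y : ℂ)⁻¹) := by
        filter_upwards [lt_mem_nhds h] with y hy
        simp [expNegInvGlue, not_le.mpr hy]
      rw [mem_ofPred_eq, he.iteratedDeriv_eq, iteratedDeriv_cexp_neg_inv_ofReal k h, one_mul]
      exact norm_iteratedDeriv_cexp_neg_inv_le k h
  have hd : closure ({0}ᶜ : Set ℝ) = univ := (dense_compl_singleton (0 : ℝ)).closure_eq
  exact fun x => hclosed.closure_subset_iff.mpr hsub (hd ▸ mem_univ x)

/-! ### A compactly supported bump with nonnegative Fourier transform. -/

/-- A nonnegative even bump function with support `(-r, r)`. -/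
noncomputable def evenBump (r x : ℝ) : ℂ :=
  (expNegInvGlue (r + x) : ℂ) * (expNegInvGlue (r - x) : ℂ)

theorem contDiff_evenBump (r : ℝ) : ContDiff ℝ ∞ (evenBump r) :=
  (contDiff_ofReal_expNegInvGlue.comp (contDiff_const.add contDiff_id)).mul
    (contDiff_ofReal_expNegInvGlue.comp (contDiff_const.sub contDiff_id))

theorem factorialSqBound_evenBump (r : ℝ) : FactorialSqBound 18 (evenBump r) := by
  have h := FactorialSqBound.mul (by norm_num)
    (contDiff_ofReal_expNegInvGlue.comp (contDiff_const.add contDiff_id))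
    (contDiff_ofReal_expNegInvGlue.comp (contDiff_const.sub contDiff_id))
    (factorialSqBound_expNegInvGlue.comp_const_add r)
    (factorialSqBound_expNegInvGlue.comp_const_sub r)
  norm_num at h
  exact h

theorem evenBump_neg (r x : ℝ) : evenBump r (-x) = evenBump r x := by
  simp [evenBump, mul_comm, sub_eq_add_neg]

theorem support_evenBump_subset (r : ℝ) : Function.support (evenBump r) ⊆ Icc (-r) r := by
  intro x hx
  simp only [evenBump, Function.mem_support, ne_eq, mul_eq_zero, Complex.ofReal_eq_zero,
    expNegInvGlue.zero_iff_nonpos, not_or, not_le] at hx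
  exact ⟨by linarith [hx.1], by linarith [hx.2]⟩

theorem hasCompactSupport_evenBump (r : ℝ) : HasCompactSupport (evenBump r) :=
  HasCompactSupport.of_support_subset_isCompact isCompact_Icc (support_evenBump_subset r)

/-- The self-convolution of `evenBump r`; its Fourier transform is nonnegative. -/
noncomputable def positiveBump (r : ℝ) : ℝ → ℂ :=
  convolution (evenBump r) (evenBump r) (ContinuousLinearMap.mul ℝ ℂ) volume

theorem integrable_evenBump (r : ℝ) : Integrable (evenBump r) :=
  (contDiff_evenBump r).continuous.integrable_of_hasCompactSupport (hasCompactSupport_evenBump r)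

theorem contDiff_positiveBump (r : ℝ) : ContDiff ℝ ∞ (positiveBump r) :=
  (hasCompactSupport_evenBump r).contDiff_convolution_right _
    (integrable_evenBump r).locallyIntegrable (contDiff_evenBump r)

theorem support_positiveBump_subset (r : ℝ) :
    Function.support (positiveBump r) ⊆ Icc (-(2 * r)) (2 * r) := by
  refine (support_convolution_subset _).trans ?_
  rintro _ ⟨x, hx, y, hy, rfl⟩
  have h1 := support_evenBump_subset r hx
  have h2 := support_evenBump_subset r hy
  exact ⟨by linarith [h1.1, h2.1], by linarith [h1.2, h2.2]⟩

theorem HasCompactSupport.iteratedDeriv_real {f : ℝ → ℂ} (hf : HasCompactSupport f) (k : ℕ) :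
    HasCompactSupport (iteratedDeriv k f) := by
  induction k with
  | zero => simpa using hf
  | succ k ih => rw [iteratedDeriv_succ]; exact ih.deriv

theorem iteratedDeriv_convolution_right {f g : ℝ → ℂ} (hf : LocallyIntegrable f)
    (hg : ContDiff ℝ ∞ g) (hgc : HasCompactSupport g) (k : ℕ) :
    iteratedDeriv k (convolution f g (ContinuousLinearMap.mul ℝ ℂ) volume) =
      convolution f (iteratedDeriv k g) (ContinuousLinearMap.mul ℝ ℂ) volume := by
  induction k with
  | zero => simp
  | succ k ih =>
    rw [iteratedDeriv_succ, ih]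
    ext x
    have h1 : ContDiff ℝ 1 (iteratedDeriv k g) :=
      iteratedDeriv_eq_iterate (n := k) (f := g) ▸
        ContDiff.iterate_deriv' 1 k (hg.of_le (by exact_mod_cast le_top))
    rw [((hgc.iteratedDeriv_real k).hasDerivAt_convolution_right _ hf h1 x).deriv,
      iteratedDeriv_succ]

/-- All derivatives are put on one factor of the convolution, so the rate stays `18`. -/
theorem factorialSqBound_positiveBump (r : ℝ) : FactorialSqBound 18 (positiveBump r) := by
  obtain ⟨C, hC, h⟩ := factorialSqBound_evenBump r
  refine ⟨(∫ y, ‖evenBump r y‖) * C, by positivity, fun k x => ?_⟩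
  rw [positiveBump, iteratedDeriv_convolution_right (integrable_evenBump r).locallyIntegrable
    (contDiff_evenBump r) (hasCompactSupport_evenBump r), convolution_def]
  calc _ ≤ ∫ y, ‖evenBump r y‖ * (C * 18 ^ k * (k ! : ℝ) ^ 2) := by
        refine norm_integral_le_of_norm_le ((integrable_evenBump r).norm.mul_const _)
          (Eventually.of_forall fun y => ?_)
        simp only [ContinuousLinearMap.mul_apply', norm_mul]
        exact mul_le_mul_of_nonneg_left (h k _) (norm_nonneg _)
    _ = _ := by rw [integral_mul_const]; ring

theorem integral_positiveBump_mul_cexp (r η : ℝ) :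
    ∫ x, positiveBump r x * Complex.exp (Complex.I * η * x) =
      (∫ x, evenBump r x * Complex.exp (Complex.I * η * x)) ^ 2 := by
  have hi : Integrable (fun x : ℝ => evenBump r x * Complex.exp (Complex.I * η * x)) := by
    refine Continuous.integrable_of_hasCompactSupport ?_ ?_
    · exact (contDiff_evenBump r).continuous.mul (contDiff_cexp_mul_ofReal _).continuous
    · exact (hasCompactSupport_evenBump r).mul_right
  have h := integral_convolution (μ := (volume : Measure ℝ)) (ν := (volume : Measure ℝ))
    (ContinuousLinearMap.mul ℝ ℂ) hi hi
  rw [ContinuousLinearMap.mul_apply', ← sq] at h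
  rw [← h]
  congr 1
  ext x
  rw [positiveBump, convolution_def, convolution_def, ← integral_mul_const]
  congr 1
  ext y
  have he : Complex.exp (Complex.I * η * x) =
      Complex.exp (Complex.I * η * y) * Complex.exp (Complex.I * η * ((x - y : ℝ) : ℂ)) := by
    rw [← Complex.exp_add]
    congr 1
    push_cast
    ring
  simp only [ContinuousLinearMap.mul_apply', he]
  ring

theorem evenBump_eq_ofReal (r x : ℝ) :
    evenBump r x = ((expNegInvGlue (r + x) * expNegInvGlue (r - x) : ℝ) : ℂ) := by
  simp [evenBump]

/-- The bump is real and even, so its Fourier transform is real; the transform of the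
self-convolution is then the square of a real number. -/
theorem conj_integral_evenBump_mul_cexp (r η : ℝ) :
    (starRingEnd ℂ) (∫ x, evenBump r x * Complex.exp (Complex.I * η * x)) =
      ∫ x, evenBump r x * Complex.exp (Complex.I * η * x) := by
  rw [← integral_conj, ← integral_neg_eq_self]
  congr 1
  ext x
  rw [evenBump_neg, map_mul, evenBump_eq_ofReal, Complex.conj_ofReal, ← Complex.exp_conj]
  simp

theorem re_integral_positiveBump_mul_cexp_nonneg (r η : ℝ) :
    0 ≤ (∫ x, positiveBump r x * Complex.exp (Complex.I * η * x)).re := by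
  obtain ⟨y, hy⟩ := Complex.conj_eq_iff_real.mp (conj_integral_evenBump_mul_cexp r η)
  rw [integral_positiveBump_mul_cexp, hy, ← Complex.ofReal_pow, Complex.ofReal_re]
  positivity

theorem re_integral_positiveBump_pos {r : ℝ} (hr : 0 < r) :
    0 < (∫ x, positiveBump r x).re := by
  have h := integral_positiveBump_mul_cexp r 0
  simp only [Complex.ofReal_zero, mul_zero, zero_mul, Complex.exp_zero, mul_one] at h
  have h2 : (∫ x, evenBump r x) =
      ((∫ x, expNegInvGlue (r + x) * expNegInvGlue (r - x) : ℝ) : ℂ) :=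
    (integral_congr_ae (Eventually.of_forall fun x => evenBump_eq_ofReal r x)).trans
      integral_ofReal
  have hc : Continuous fun x => expNegInvGlue (r + x) * expNegInvGlue (r - x) := by
    have h0 : Continuous expNegInvGlue := (expNegInvGlue.contDiff (n := 0)).continuous
    fun_prop
  have hs : HasCompactSupport fun x => expNegInvGlue (r + x) * expNegInvGlue (r - x) := by
    refine HasCompactSupport.of_support_subset_isCompact (isCompact_Icc (a := -r) (b := r)) ?_
    intro x hx
    apply support_evenBump_subset r
    rw [Function.mem_support, evenBump_eq_ofReal]
    exact_mod_cast hx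
  have hpos : 0 < ∫ x, expNegInvGlue (r + x) * expNegInvGlue (r - x) :=
    hc.integral_pos_of_hasCompactSupport_nonneg_nonzero hs
      (fun x => mul_nonneg (expNegInvGlue.nonneg _) (expNegInvGlue.nonneg _)) (x := 0) (by
        have := expNegInvGlue.pos_of_pos hr
        simp [hr])
  rw [h, h2, ← Complex.ofReal_pow, Complex.ofReal_re]
  positivity

/-! ### The initial datum: an exponential series of Gevrey order `s`. -/

/-- The exponential `e^{-j} ξ_j ^ k e^{i ξ_j x}` with frequency `ξ_j = j ^ s`. -/
noncomputable def exponentialTerm (s : ℝ) (k j : ℕ) (x : ℝ) : ℂ :=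
  ((Real.exp (-j) * ((j : ℝ) ^ s) ^ k : ℝ) : ℂ) *
    Complex.exp (Complex.I * ((j : ℝ) ^ s : ℝ) * x)

/-- The sum `∑ e^{-j} ξ_j ^ k e^{i ξ_j x}` over the frequencies `ξ_j = j ^ s`; for `k = 0` it is a
function in the Gevrey class of order `s`. -/
noncomputable def exponentialSeries (s : ℝ) (k : ℕ) (x : ℝ) : ℂ :=
  ∑' j : ℕ, exponentialTerm s k j x

theorem norm_exponentialTerm (s : ℝ) (k j : ℕ) (x : ℝ) :
    ‖exponentialTerm s k j x‖ = Real.exp (-j) * ((j : ℝ) ^ s) ^ k := by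
  rw [exponentialTerm, norm_mul, norm_cexp_I_mul_ofReal, mul_one, Complex.norm_real,
    Real.norm_of_nonneg (by positivity)]

/-- The inequality `y^k ≤ k! e^y` at `y = j/(2s)`, raised to the power `s`, costs `e^{j/2}`. Half of
the decay `e^{-j}` is left for summing over `j`. -/
theorem exp_neg_mul_rpow_pow_le {s : ℝ} (hs : 0 < s) (k j : ℕ) :
    Real.exp (-j) * ((j : ℝ) ^ s) ^ k ≤
      (((2 * s) ^ s) ^ k * (k ! : ℝ) ^ s) * Real.exp (-(1 / 2)) ^ j := by
  have h := Real.pow_div_factorial_le_exp (j / (2 * s)) (by positivity) k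
  rw [div_le_iff₀ (by positivity), div_pow, div_le_iff₀ (by positivity)] at h
  have h1 : ((j : ℝ) ^ s) ^ k = ((j : ℝ) ^ k) ^ s := Real.rpow_pow_comm (by positivity) s k
  have h2 : ((2 * s) ^ s) ^ k = ((2 * s) ^ k) ^ s := Real.rpow_pow_comm (by positivity) s k
  have h3 : ((j : ℝ) ^ k) ^ s ≤
      Real.exp (j / 2) * (k ! : ℝ) ^ s * ((2 * s) ^ k) ^ s := by
    refine (Real.rpow_le_rpow (by positivity) h hs.le).trans_eq ?_
    rw [Real.mul_rpow (by positivity) (by positivity), Real.mul_rpow (by positivity)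
      (by positivity), ← Real.exp_mul]
    congr 3
    field_simp
  rw [h1, h2]
  calc _ ≤ Real.exp (-j) * (Real.exp (j / 2) * (k ! : ℝ) ^ s * ((2 * s) ^ k) ^ s) := by gcongr
    _ = (((2 * s) ^ k) ^ s * (k ! : ℝ) ^ s) * (Real.exp (-j) * Real.exp (j / 2)) := by ring
    _ = _ := by
      rw [← Real.exp_add, ← Real.exp_nat_mul]
      congr 2
      ring

theorem summable_exp_neg_half_pow : Summable fun j : ℕ => Real.exp (-(1 / 2)) ^ j :=
  summable_geometric_of_lt_one (Real.exp_pos _).le (Real.exp_lt_one_iff.mpr (by norm_num))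

theorem summable_exp_neg_mul_rpow_pow {s : ℝ} (hs : 0 < s) (k : ℕ) :
    Summable fun j : ℕ => Real.exp (-j) * ((j : ℝ) ^ s) ^ k :=
  Summable.of_nonneg_of_le (fun j => by positivity) (exp_neg_mul_rpow_pow_le hs k)
    (summable_exp_neg_half_pow.mul_left _)

theorem hasDerivAt_exponentialTerm (s : ℝ) (k j : ℕ) (x : ℝ) :
    HasDerivAt (exponentialTerm s k j) (Complex.I * exponentialTerm s (k + 1) j x) x := by
  have h := (hasDerivAt_cexp_mul_ofReal (Complex.I * ((j : ℝ) ^ s : ℝ)) x).const_mul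
    ((Real.exp (-j) * ((j : ℝ) ^ s) ^ k : ℝ) : ℂ)
  refine h.congr_deriv ?_
  simp only [exponentialTerm]
  push_cast
  ring

theorem summable_exponentialTerm {s : ℝ} (hs : 0 < s) (k : ℕ) (x : ℝ) :
    Summable fun j => exponentialTerm s k j x := by
  apply Summable.of_norm
  simp only [norm_exponentialTerm]
  exact summable_exp_neg_mul_rpow_pow hs k

theorem hasDerivAt_exponentialSeries {s : ℝ} (hs : 0 < s) (k : ℕ) (x : ℝ) :
    HasDerivAt (exponentialSeries s k) (Complex.I * exponentialSeries s (k + 1) x) x := by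
  have h := hasDerivAt_tsum (summable_exp_neg_mul_rpow_pow hs (k + 1))
    (fun j y => hasDerivAt_exponentialTerm s k j y)
    (fun j y => by rw [norm_mul, Complex.norm_I, one_mul, norm_exponentialTerm])
    (summable_exponentialTerm hs k 0) x
  rwa [tsum_mul_left] at h

theorem iteratedDeriv_exponentialSeries {s : ℝ} (hs : 0 < s) (k : ℕ) :
    iteratedDeriv k (exponentialSeries s 0) = fun x => Complex.I ^ k * exponentialSeries s k x := by
  induction k with
  | zero => simp
  | succ k ih =>
    rw [iteratedDeriv_succ, ih]
    ext x
    rw [((hasDerivAt_exponentialSeries hs k x).const_mul _).deriv]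
    ring

theorem exponentialSeries_mem_gevreyClass {s : ℝ} (hs : 0 < s) :
    exponentialSeries s 0 ∈ gevreyClass s := by
  refine ⟨?_, fun K _ => ⟨∑' j : ℕ, Real.exp (-(1 / 2)) ^ j, ((2 * s) ^ s)⁻¹, ?_, by positivity,
    fun x _ k => ?_⟩⟩
  · apply contDiff_of_differentiable_iteratedDeriv
    intro m _
    rw [iteratedDeriv_exponentialSeries hs]
    exact fun x => ((hasDerivAt_exponentialSeries hs m x).const_mul _).differentiableAt
  · exact summable_exp_neg_half_pow.tsum_pos (fun j => by positivity) 0 (by simp)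
  · rw [iteratedDeriv_exponentialSeries hs, norm_mul, norm_pow, Complex.norm_I, one_pow, one_mul,
      inv_inv]
    have h := tsum_of_norm_bounded (summable_exp_neg_half_pow.mul_left
      (((2 * s) ^ s) ^ k * (k ! : ℝ) ^ s)).hasSum fun j =>
        (norm_exponentialTerm s k j x).le.trans (exp_neg_mul_rpow_pow_le hs k j)
    rw [tsum_mul_left] at h
    exact h.trans_eq (by ring)

theorem continuous_exponentialSeries {s : ℝ} (hs : 0 < s) (k : ℕ) :
    Continuous (exponentialSeries s k) :=
  continuous_iff_continuousAt.mpr fun x => (hasDerivAt_exponentialSeries hs k x).continuousAt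

/-- Pairing with an oscillating test function whose amplitude has nonnegative Fourier transform
is bounded below by the contribution of a single frequency. -/
theorem le_re_integral_exponentialSeries_mul {s : ℝ} (hs : 0 < s) {χ : ℝ → ℂ}
    (hχ : Continuous χ) (hχc : HasCompactSupport χ)
    (hpos : ∀ η : ℝ, 0 ≤ (∫ x, χ x * Complex.exp (Complex.I * η * x)).re) (k m : ℕ) :
    Real.exp (-m) * ((m : ℝ) ^ s) ^ k * (∫ x, χ x).re ≤
      (∫ x, exponentialSeries s k x *
        (χ x * Complex.exp (Complex.I * (-(m : ℝ) ^ s : ℝ) * x))).re := by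
  set g : ℝ → ℂ := fun x => χ x * Complex.exp (Complex.I * (-(m : ℝ) ^ s : ℝ) * x) with hg
  have hgc : Continuous g := hχ.mul (contDiff_cexp_mul_ofReal _).continuous
  have hgs : HasCompactSupport g := hχc.mul_right
  have hgi : Integrable g := hgc.integrable_of_hasCompactSupport hgs
  -- Each term is a nonnegative multiple of the Fourier transform of `χ` at a difference of
  -- frequencies; for `j = m` the difference is zero and the integral is `∫ χ`.
  have hterm (j : ℕ) : ∫ x, exponentialTerm s k j x * g x =
      ((Real.exp (-j) * ((j : ℝ) ^ s) ^ k : ℝ) : ℂ) *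
        ∫ x, χ x * Complex.exp (Complex.I * ((j : ℝ) ^ s - (m : ℝ) ^ s : ℝ) * x) := by
    rw [← integral_const_mul]
    congr 1
    ext x
    have he : Complex.exp (Complex.I * ((j : ℝ) ^ s - (m : ℝ) ^ s : ℝ) * x) =
        Complex.exp (Complex.I * ((j : ℝ) ^ s : ℝ) * x) *
          Complex.exp (Complex.I * (-(m : ℝ) ^ s : ℝ) * x) := by
      rw [← Complex.exp_add]
      congr 1
      push_cast
      ring
    rw [he, exponentialTerm, hg]
    ring
  have hcont (j : ℕ) : Continuous (exponentialTerm s k j) :=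
    continuous_iff_continuousAt.mpr fun x => (hasDerivAt_exponentialTerm s k j x).continuousAt
  have hsum : HasSum (fun j => ∫ x, exponentialTerm s k j x * g x)
      (∫ x, ∑' j, exponentialTerm s k j x * g x) := by
    refine hasSum_integral_of_summable_integral_norm (fun j => ?_) ?_
    · exact ((hcont j).mul hgc).integrable_of_hasCompactSupport hgs.mul_left
    · simp only [norm_mul, norm_exponentialTerm, integral_const_mul]
      exact (summable_exp_neg_mul_rpow_pow hs k).mul_right _
  simp only [tsum_mul_right] at hsum
  have hre := Complex.hasSum_re hsum
  have hle := hre.summable.le_tsum m fun j _ => by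
    rw [hterm, Complex.re_ofReal_mul]
    exact mul_nonneg (by positivity) (hpos _)
  rw [hre.tsum_eq, hterm, Complex.re_ofReal_mul] at hle
  simpa [hg, exponentialSeries] using hle

/-! ### Differentiation under the integral and Taylor's formula, with one-sided derivatives. -/

theorem continuousOn_slice_right {f : ℝ × ℝ → ℂ} {S K : Set ℝ} (hf : ContinuousOn f (S ×ˢ K))
    {t : ℝ} (ht : t ∈ S) : ContinuousOn (fun x => f (t, x)) K :=
  hf.comp (by fun_prop) fun _ hx => ⟨ht, hx⟩

/-- Difference quotients converge pointwise and, by the mean value inequality, are dominated by the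
bound of `f'` on the compact rectangle. -/
theorem hasDerivWithinAt_integral_mul {T a b : ℝ} (hab : a ≤ b) {f f' : ℝ × ℝ → ℂ} {g : ℝ → ℂ}
    (hf : ContinuousOn f (Icc 0 T ×ˢ Icc a b)) (hf' : ContinuousOn f' (Icc 0 T ×ˢ Icc a b))
    (hd : ∀ t ∈ Icc 0 T, ∀ x ∈ Icc a b,
      HasDerivWithinAt (fun τ => f (τ, x)) (f' (t, x)) (Icc 0 T) t)
    (hg : Continuous g) {t : ℝ} (ht : t ∈ Icc 0 T) :
    HasDerivWithinAt (fun τ => ∫ x in a..b, f (τ, x) * g x) (∫ x in a..b, f' (t, x) * g x)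
      (Icc 0 T) t := by
  obtain ⟨B, hB⟩ := (isCompact_Icc.prod isCompact_Icc).exists_bound_of_continuousOn hf'
  have hsub : uIoc a b ⊆ Icc a b := by rw [uIoc_of_le hab]; exact Ioc_subset_Icc_self
  have hii : ∀ τ ∈ Icc 0 T, IntervalIntegrable (fun x => f (τ, x) * g x) volume a b :=
    fun τ hτ => by
      refine ContinuousOn.intervalIntegrable ?_
      rw [uIcc_of_le hab]
      exact (continuousOn_slice_right hf hτ).mul hg.continuousOn
  have hmem : ∀ᶠ τ in 𝓝[Icc 0 T \ {t}] t, τ ∈ Icc 0 T \ {t} := self_mem_nhdsWithin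
  rw [hasDerivWithinAt_iff_tendsto_slope]
  have key : Tendsto (fun τ => ∫ x in a..b, slope (fun σ => f (σ, x)) t τ * g x)
      (𝓝[Icc 0 T \ {t}] t) (𝓝 (∫ x in a..b, f' (t, x) * g x)) := by
    refine intervalIntegral.tendsto_integral_filter_of_dominated_convergence
      (fun x => B * ‖g x‖) ?_ ?_ ?_ ?_
    · filter_upwards [hmem] with τ hτ
      refine ContinuousOn.aestronglyMeasurable (ContinuousOn.mul ?_ hg.continuousOn)
        measurableSet_uIoc
      simp only [slope_def_module]
      exact (((continuousOn_slice_right hf hτ.1).sub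
        (continuousOn_slice_right hf ht)).const_smul _).mono hsub
    · filter_upwards [hmem] with τ hτ
      refine Eventually.of_forall fun x hx => ?_
      rw [norm_mul]
      refine mul_le_mul_of_nonneg_right ?_ (norm_nonneg _)
      have h := Convex.norm_image_sub_le_of_norm_hasDerivWithin_le
        (fun σ hσ => hd σ hσ x (hsub hx)) (fun σ hσ => hB (σ, x) ⟨hσ, hsub hx⟩)
        (convex_Icc 0 T) ht hτ.1
      have hne : 0 < ‖τ - t‖ := norm_pos_iff.mpr (sub_ne_zero.mpr hτ.2)
      rw [slope_def_module, norm_smul, norm_inv, inv_mul_le_iff₀ hne, mul_comm]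
      exact h
    · exact (continuous_const.mul hg.norm).intervalIntegrable a b
    · refine Eventually.of_forall fun x hx => ?_
      exact (hasDerivWithinAt_iff_tendsto_slope.mp (hd t ht x (hsub hx))).mul_const _
  refine key.congr' ?_
  filter_upwards [hmem] with τ hτ
  rw [slope_def_module, ← intervalIntegral.integral_sub (hii τ hτ.1) (hii t ht),
    ← intervalIntegral.integral_smul]
  refine intervalIntegral.integral_congr fun x _ => ?_
  simp only [slope_def_module, Complex.real_smul]
  ring

theorem norm_sub_taylor_le {T M : ℝ} (hT : 0 < T) {G : ℕ → ℝ → ℂ}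
    (hG : ∀ n, ∀ t ∈ Icc 0 T, HasDerivWithinAt (G n) (G (n + 1) t) (Icc 0 T) t) (n : ℕ)
    (hM : ∀ t ∈ Icc 0 T, ‖G (n + 1) t‖ ≤ M) :
    ‖G 0 T - ∑ k ∈ Finset.range (n + 1), ((T ^ k / k ! : ℝ) : ℂ) * G k 0‖ ≤
      M * T ^ (n + 1) / n ! := by
  have hu : UniqueDiffOn ℝ (Icc 0 T) := uniqueDiffOn_Icc hT
  have hit (k : ℕ) : ∀ t ∈ Icc 0 T, iteratedDerivWithin k (G 0) (Icc 0 T) t = G k t := by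
    induction k with
    | zero => simp
    | succ k ih =>
      intro t ht
      rw [iteratedDerivWithin_succ, derivWithin_congr ih (ih t ht), (hG k t ht).derivWithin
        (hu t ht)]
  have hc : ContDiffOn ℝ (n + 1) (G 0) (Icc 0 T) := by
    have : ContDiffOn ℝ ((n + 1 : ℕ) : ℕ∞) (G 0) (Icc 0 T) := by
      refine contDiffOn_of_differentiableOn_deriv fun m _ t ht => ?_
      exact (hG m t ht).differentiableWithinAt.congr (hit m) (hit m t ht)
    exact_mod_cast this
  have h := taylor_mean_remainder_bound hT.le hc (right_mem_Icc.mpr hT.le)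
    (fun t ht => by rw [hit _ t ht]; exact hM t ht)
  rw [sub_zero, taylor_within_apply] at h
  refine (le_of_eq ?_).trans h
  congr 2
  refine Finset.sum_congr rfl fun k _ => ?_
  rw [hit k 0 (left_mem_Icc.mpr hT.le), Complex.real_smul, sub_zero, div_eq_inv_mul]

/-! ### Pairing a solution on a rectangle with a test function. -/

/-- On the rectangle `[0, T] × [-δ, δ]` the function `u` is continuous together with its
derivatives `v = ∂_t u`, `w = ∂_t² u`, `z = ∂_x u`, and satisfies `w + i z = 0`. -/
structure IsRectangleSolution (T δ : ℝ) (u v w z : ℝ × ℝ → ℂ) : Prop where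
  continuousOn_u : ContinuousOn u (Icc 0 T ×ˢ Icc (-δ) δ)
  continuousOn_v : ContinuousOn v (Icc 0 T ×ˢ Icc (-δ) δ)
  continuousOn_w : ContinuousOn w (Icc 0 T ×ˢ Icc (-δ) δ)
  continuousOn_z : ContinuousOn z (Icc 0 T ×ˢ Icc (-δ) δ)
  hasDeriv_u : ∀ t ∈ Icc 0 T, ∀ x ∈ Icc (-δ) δ,
    HasDerivWithinAt (fun τ => u (τ, x)) (v (t, x)) (Icc 0 T) t
  hasDeriv_v : ∀ t ∈ Icc 0 T, ∀ x ∈ Icc (-δ) δ,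
    HasDerivWithinAt (fun τ => v (τ, x)) (w (t, x)) (Icc 0 T) t
  hasDeriv_x : ∀ t ∈ Icc 0 T, ∀ x ∈ Icc (-δ) δ,
    HasDerivWithinAt (fun y => u (t, y)) (z (t, x)) (Icc (-δ) δ) x
  equation : ∀ t ∈ Icc 0 T, ∀ x ∈ Icc (-δ) δ, w (t, x) + Complex.I * z (t, x) = 0

theorem IsRectangleSolution.mono {T T' δ : ℝ} {u v w z : ℝ × ℝ → ℂ}
    (h : IsRectangleSolution T δ u v w z) (hT : T' ≤ T) : IsRectangleSolution T' δ u v w z := by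
  have hs : Icc 0 T' ⊆ Icc 0 T := Icc_subset_Icc_right hT
  have hp : Icc 0 T' ×ˢ Icc (-δ) δ ⊆ Icc 0 T ×ˢ Icc (-δ) δ := prod_mono_left hs
  exact ⟨h.continuousOn_u.mono hp, h.continuousOn_v.mono hp, h.continuousOn_w.mono hp,
    h.continuousOn_z.mono hp, fun t ht x hx => (h.hasDeriv_u t (hs ht) x hx).mono hs,
    fun t ht x hx => (h.hasDeriv_v t (hs ht) x hx).mono hs,
    fun t ht x hx => h.hasDeriv_x t (hs ht) x hx, fun t ht x hx => h.equation t (hs ht) x hx⟩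

theorem tsupport_iteratedDeriv_real_subset (g : ℝ → ℂ) (k : ℕ) :
    tsupport (iteratedDeriv k g) ⊆ tsupport g := by
  induction k with
  | zero => simp
  | succ k ih => rw [iteratedDeriv_succ]; exact tsupport_deriv_subset.trans ih

theorem hasDerivAt_iteratedDeriv_real {g : ℝ → ℂ} (hg : ContDiff ℝ ∞ g) (k : ℕ) (x : ℝ) :
    HasDerivAt (iteratedDeriv k g) (iteratedDeriv (k + 1) g x) x := by
  rw [iteratedDeriv_succ]
  exact (hg.differentiable_iteratedDeriv k (by exact_mod_cast ENat.natCast_lt_top k) x).hasDerivAt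

theorem continuous_iteratedDeriv_real {g : ℝ → ℂ} (hg : ContDiff ℝ ∞ g) (k : ℕ) :
    Continuous (iteratedDeriv k g) :=
  hg.continuous_iteratedDeriv k (by exact_mod_cast le_top)

/-- Substitute `w = -i z` and integrate by parts in `x`; the support of `g` removes the boundary
terms. -/
theorem IsRectangleSolution.integral_w {T δ : ℝ} {u v w z : ℝ × ℝ → ℂ}
    (h : IsRectangleSolution T δ u v w z) (hδ : 0 < δ) {g : ℝ → ℂ} (hg : ContDiff ℝ ∞ g)
    (hgs : tsupport g ⊆ Ioo (-δ) δ) (k : ℕ) {t : ℝ} (ht : t ∈ Icc 0 T) :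
    ∫ x in (-δ)..δ, w (t, x) * (Complex.I ^ k * iteratedDeriv k g x) =
      ∫ x in (-δ)..δ, u (t, x) * (Complex.I ^ (k + 1) * iteratedDeriv (k + 1) g x) := by
  have huI : uIcc (-δ) δ = Icc (-δ) δ := uIcc_of_le (by linarith)
  have hzero : ∀ x, x ∉ Ioo (-δ) δ → iteratedDeriv k g x = 0 := fun x hx =>
    image_eq_zero_of_notMem_tsupport fun hx' =>
      hx (hgs (tsupport_iteratedDeriv_real_subset g k hx'))
  have hparts := intervalIntegral.integral_mul_deriv_eq_deriv_mul_of_hasDerivWithinAt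
    (a := -δ) (b := δ) (u := fun x => u (t, x)) (u' := fun x => z (t, x))
    (v := iteratedDeriv k g) (v' := iteratedDeriv (k + 1) g)
    (by rw [huI]; exact h.hasDeriv_x t ht)
    (fun x _ => (hasDerivAt_iteratedDeriv_real hg k x).hasDerivWithinAt)
    (by
      refine ContinuousOn.intervalIntegrable ?_
      rw [huI]
      exact continuousOn_slice_right h.continuousOn_z ht)
    ((continuous_iteratedDeriv_real hg (k + 1)).intervalIntegrable _ _)
  rw [hzero δ (by simp), hzero (-δ) (by simp), mul_zero, mul_zero, sub_zero, zero_sub] at hparts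
  calc _ = ∫ x in (-δ)..δ, Complex.I ^ (k + 1) * -(z (t, x) * iteratedDeriv k g x) := by
        refine intervalIntegral.integral_congr fun x hx => ?_
        rw [huI] at hx
        simp only [eq_neg_of_add_eq_zero_left (h.equation t ht x hx)]
        ring
    _ = Complex.I ^ (k + 1) * ∫ x in (-δ)..δ, u (t, x) * iteratedDeriv (k + 1) g x := by
        rw [intervalIntegral.integral_const_mul, intervalIntegral.integral_neg, hparts]
    _ = _ := by
        rw [← intervalIntegral.integral_const_mul]
        congr 1
        ext x
        ring

theorem IsRectangleSolution.norm_sub_taylor_le {T δ B C a : ℝ} {u v w z : ℝ × ℝ → ℂ}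
    (h : IsRectangleSolution T δ u v w z) (hT : 0 < T) (hδ : 0 < δ) {g : ℝ → ℂ}
    (hg : ContDiff ℝ ∞ g) (hgs : tsupport g ⊆ Ioo (-δ) δ)
    (hB : ∀ p ∈ Icc 0 T ×ˢ Icc (-δ) δ, ‖u p‖ ≤ B)
    (hC : ∀ k x, ‖iteratedDeriv k g x‖ ≤ C * a ^ k * (k ! : ℝ) ^ 2)
    (hv : ∀ x ∈ Icc (-δ) δ, v (0, x) = 0) (n : ℕ) :
    ‖(∫ x in (-δ)..δ, u (T, x) * g x) - ∑ k ∈ Finset.range (n + 1),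
        ((T ^ (2 * k) / (2 * k)! : ℝ) : ℂ) *
          ∫ x in (-δ)..δ, u (0, x) * (Complex.I ^ k * iteratedDeriv k g x)‖ ≤
      B * (C * a ^ (n + 1) * ((n + 1)! : ℝ) ^ 2) * (2 * δ) * T ^ (2 * n + 2) / (2 * n + 1)! := by
  have huI : uIcc (-δ) δ = Icc (-δ) δ := uIcc_of_le (by linarith)
  have hgk (k : ℕ) : Continuous fun x => Complex.I ^ k * iteratedDeriv k g x :=
    continuous_const.mul (continuous_iteratedDeriv_real hg k)
  -- `G n` is the `n`-th `t`-derivative of the pairing: even orders pair `u`, odd orders `v`, and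
  -- each two steps put one more `i ∂_x` on `g`.
  set G : ℕ → ℝ → ℂ := fun n t => ∫ x in (-δ)..δ,
    (if Even n then u (t, x) else v (t, x)) *
      (Complex.I ^ (n / 2) * iteratedDeriv (n / 2) g x) with hGdef
  have hGe (k : ℕ) : G (2 * k) = fun t => ∫ x in (-δ)..δ,
      u (t, x) * (Complex.I ^ k * iteratedDeriv k g x) := by
    simp [hGdef]
  have hGo (k : ℕ) : G (2 * k + 1) = fun t => ∫ x in (-δ)..δ,
      v (t, x) * (Complex.I ^ k * iteratedDeriv k g x) := by
    have : (2 * k + 1) / 2 = k := by omega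
    simp [hGdef, this]
  have hG : ∀ n, ∀ t ∈ Icc 0 T, HasDerivWithinAt (G n) (G (n + 1) t) (Icc 0 T) t := by
    intro n t ht
    obtain ⟨k, rfl | rfl⟩ := Nat.even_or_odd' n
    · rw [hGe, hGo]
      exact hasDerivWithinAt_integral_mul (by linarith) h.continuousOn_u h.continuousOn_v
        h.hasDeriv_u (hgk k) ht
    · rw [hGo, show 2 * k + 1 + 1 = 2 * (k + 1) by ring, hGe]
      simp only
      rw [← h.integral_w hδ hg hgs k ht]
      exact hasDerivWithinAt_integral_mul (by linarith) h.continuousOn_v h.continuousOn_w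
        h.hasDeriv_v (hgk k) ht
  have hM : ∀ t ∈ Icc 0 T, ‖G (2 * n + 1 + 1) t‖ ≤
      B * (C * a ^ (n + 1) * ((n + 1)! : ℝ) ^ 2) * (2 * δ) := fun t ht => by
    rw [show 2 * n + 1 + 1 = 2 * (n + 1) by ring, hGe]
    have := intervalIntegral.norm_integral_le_of_norm_le_const (a := -δ) (b := δ)
      (C := B * (C * a ^ (n + 1) * ((n + 1)! : ℝ) ^ 2))
      (f := fun x => u (t, x) * (Complex.I ^ (n + 1) * iteratedDeriv (n + 1) g x)) (by
        intro x hx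
        rw [uIoc_of_le (by linarith)] at hx
        have h1 := hB (t, x) ⟨ht, Ioc_subset_Icc_self hx⟩
        rw [norm_mul, norm_mul, norm_pow, Complex.norm_I, one_pow, one_mul]
        exact mul_le_mul h1 (hC _ _) (norm_nonneg _) ((norm_nonneg _).trans h1))
    rwa [show |δ - -δ| = 2 * δ by rw [abs_of_pos] <;> linarith] at this
  have hfin := _root_.norm_sub_taylor_le hT hG (2 * n + 1) hM
  -- Odd Taylor coefficients vanish because `v = 0` at `t = 0`.
  have hsum : ∀ N : ℕ, ∑ k ∈ Finset.range (2 * N), ((T ^ k / k ! : ℝ) : ℂ) * G k 0 =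
      ∑ k ∈ Finset.range N, ((T ^ (2 * k) / (2 * k)! : ℝ) : ℂ) *
          ∫ x in (-δ)..δ, u (0, x) * (Complex.I ^ k * iteratedDeriv k g x) := fun N => by
    induction N with
    | zero => simp
    | succ N ih =>
      have hodd : G (2 * N + 1) 0 = 0 := by
        rw [hGo]
        refine intervalIntegral.integral_zero_ae (Eventually.of_forall fun x hx => ?_)
        rw [uIoc_of_le (by linarith)] at hx
        rw [hv x (Ioc_subset_Icc_self hx), zero_mul]
      rw [show 2 * (N + 1) = 2 * N + 1 + 1 by ring, Finset.sum_range_succ, Finset.sum_range_succ,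
        Finset.sum_range_succ, ih, hodd, hGe, mul_zero, add_zero]
  rw [show 2 * n + 1 + 1 = 2 * (n + 1) by ring, hsum, show G 0 = G (2 * 0) from rfl, hGe] at hfin
  simpa [mul_add] using hfin

/-- Each integration by parts moves `i ∂_x` to the series as `-i ∂_x`, which multiplies the mode of
frequency `ξ_j` by `ξ_j`. -/
theorem integral_exponentialSeries_mul_iteratedDeriv {s : ℝ} (hs : 0 < s) {g : ℝ → ℂ}
    (hg : ContDiff ℝ ∞ g) (hgc : HasCompactSupport g) (k : ℕ) :
    ∫ x, exponentialSeries s 0 x * (Complex.I ^ k * iteratedDeriv k g x) =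
      ∫ x, exponentialSeries s k x * g x := by
  have hstep (j l : ℕ) : ∫ x, exponentialSeries s j x * (Complex.I * iteratedDeriv (l + 1) g x) =
      ∫ x, exponentialSeries s (j + 1) x * iteratedDeriv l g x := by
    have hcs := continuous_exponentialSeries hs
    have hsup := hgc.iteratedDeriv_real
    have hcg := continuous_iteratedDeriv_real hg
    have hp := integral_mul_deriv_eq_deriv_mul_of_integrable
      (u := exponentialSeries s j) (v := iteratedDeriv l g)
      (fun x _ => hasDerivAt_exponentialSeries hs j x)
      (fun x _ => hasDerivAt_iteratedDeriv_real hg l x)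
      (((hcs j).mul (hcg (l + 1))).integrable_of_hasCompactSupport (hsup (l + 1)).mul_left)
      (((continuous_const.mul (hcs (j + 1))).mul (hcg l)).integrable_of_hasCompactSupport
        (hsup l).mul_left)
      (((hcs j).mul (hcg l)).integrable_of_hasCompactSupport (hsup l).mul_left)
    simp only [mul_left_comm _ Complex.I, mul_assoc Complex.I, integral_const_mul] at hp ⊢
    rw [hp]
    linear_combination (-∫ x, exponentialSeries s (j + 1) x * iteratedDeriv l g x) * Complex.I_mul_I
  have hgen (k j : ℕ) : ∫ x, exponentialSeries s j x * (Complex.I ^ k * iteratedDeriv k g x) =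
      ∫ x, exponentialSeries s (j + k) x * g x := by
    induction k generalizing j with
    | zero => simp
    | succ k ih =>
      rw [show j + (k + 1) = (j + 1) + k by ring, ← ih (j + 1)]
      have h1 := hstep j k
      simp only [mul_left_comm _ (Complex.I ^ _), mul_left_comm _ Complex.I,
        integral_const_mul] at h1 ⊢
      rw [← h1]
      ring
  simpa using hgen k 0

/-! ### The limits in `n` and `m`, and the contradiction. -/

theorem tsupport_positiveBump_subset {r δ : ℝ} (h : 2 * r < δ) :
    tsupport (positiveBump r) ⊆ Ioo (-δ) δ :=
  (closure_minimal (support_positiveBump_subset r) isClosed_Icc).trans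
    fun _ hx => ⟨by linarith [hx.1], by linarith [hx.2]⟩

theorem hasCompactSupport_positiveBump (r : ℝ) : HasCompactSupport (positiveBump r) :=
  HasCompactSupport.of_support_subset_isCompact isCompact_Icc (support_positiveBump_subset r)

/-- Since `((n+1)!)^2 ≤ (2n+2)!`, the factorials cancel up to the factor `2n+2`, and `36 T^2 < 1/2`
leaves a geometric decay. -/
theorem tendsto_taylor_remainder {B C T δ : ℝ} (hB : 0 ≤ B) (hC : 0 ≤ C) (hT : 0 < T)
    (hT' : T ≤ 1 / 10) (hδ : 0 < δ) :
    Tendsto (fun n : ℕ => B * (C * 36 ^ (n + 1) * ((n + 1)! : ℝ) ^ 2) * (2 * δ) *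
      T ^ (2 * n + 2) / (2 * n + 1)!) atTop (𝓝 0) := by
  have h0 : Tendsto (fun n : ℕ => 2 * (B * C * (2 * δ)) * (((n + 1 : ℕ) : ℝ) * (1 / 2) ^ (n + 1)))
      atTop (𝓝 0) := by
    have := ((tendsto_self_mul_const_pow_of_lt_one (r := (1 / 2 : ℝ)) (by norm_num)
      (by norm_num)).comp (tendsto_add_atTop_nat 1)).const_mul (2 * (B * C * (2 * δ)))
    simpa using this
  refine squeeze_zero (fun n => by positivity) (fun n => ?_) h0
  rw [div_le_iff₀ (by positivity)]
  have h1 : ((n + 1)! : ℝ) ^ 2 ≤ 2 * ((n + 1 : ℕ) : ℝ) * (2 * n + 1)! := by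
    have h2 : (n + 1)! * (n + 1)! ≤ (2 * n + 2)! := by
      have := Nat.le_of_dvd (Nat.factorial_pos _)
        (Nat.factorial_mul_factorial_dvd_factorial_add (n + 1) (n + 1))
      rwa [show n + 1 + (n + 1) = 2 * n + 2 by ring] at this
    rw [Nat.factorial_succ (2 * n + 1)] at h2
    have h3 : ((n + 1)! : ℝ) * (n + 1)! ≤ (2 * n + 1 + 1) * (2 * n + 1)! := by exact_mod_cast h2
    rw [sq]
    refine h3.trans_eq ?_
    push_cast
    ring
  have h4 : (36 * T ^ 2) ^ (n + 1) ≤ (1 / 2) ^ (n + 1) := by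
    gcongr
    nlinarith
  calc B * (C * 36 ^ (n + 1) * ((n + 1)! : ℝ) ^ 2) * (2 * δ) * T ^ (2 * n + 2)
      = B * C * (2 * δ) * ((36 * T ^ 2) ^ (n + 1) * ((n + 1)! : ℝ) ^ 2) := by
        rw [mul_pow, ← pow_mul]; ring
    _ ≤ B * C * (2 * δ) * ((1 / 2) ^ (n + 1) * (2 * ((n + 1 : ℕ) : ℝ) * (2 * n + 1)!)) := by
        gcongr
    _ = _ := by ring

/-- The exponent `m (T m^{s/2-1} - 1)` tends to infinity exactly because `s/2 - 1 > 0`. -/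
theorem tendsto_exp_neg_mul_cosh {s T : ℝ} (hs : 2 < s) (hT : 0 < T) :
    Tendsto (fun m : ℕ => Real.exp (-m) * Real.cosh (T * (m : ℝ) ^ (s / 2))) atTop atTop := by
  have h1 : Tendsto (fun m : ℕ => (m : ℝ) * (T * (m : ℝ) ^ (s / 2 - 1) + -1)) atTop atTop := by
    refine tendsto_natCast_atTop_atTop.atTop_mul_atTop₀ ?_
    refine tendsto_atTop_add_const_right _ _ (Tendsto.const_mul_atTop hT ?_)
    exact (tendsto_rpow_atTop (by linarith)).comp tendsto_natCast_atTop_atTop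
  have h2 := (Real.tendsto_exp_atTop.comp h1).const_mul_atTop (r := 1 / 2) (by norm_num)
  refine tendsto_atTop_mono' _ ?_ h2
  filter_upwards [eventually_gt_atTop 0] with m hm
  have hm' : (0 : ℝ) < m := by exact_mod_cast hm
  have h3 : (m : ℝ) * (T * (m : ℝ) ^ (s / 2 - 1) + -1) = -m + T * (m : ℝ) ^ (s / 2) := by
    rw [Real.rpow_sub_one hm'.ne']
    field_simp
    ring
  rw [Function.comp_apply, h3, Real.exp_add, Real.cosh_eq]
  have := Real.exp_pos (-(m : ℝ))
  have := mul_pos this (Real.exp_pos (-(T * (m : ℝ) ^ (s / 2))))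
  linarith

theorem IsRectangleSolution.exp_neg_mul_cosh_le {s T δ B D : ℝ} {u v w z : ℝ × ℝ → ℂ}
    (h : IsRectangleSolution T δ u v w z) (hs : 0 < s) (hT : 0 < T) (hT' : T ≤ 1 / 10)
    (hδ : 0 < δ) (hu : ∀ x ∈ Icc (-δ) δ, u (0, x) = exponentialSeries s 0 x)
    (hv : ∀ x ∈ Icc (-δ) δ, v (0, x) = 0) (hB0 : 0 ≤ B)
    (hB : ∀ p ∈ Icc 0 T ×ˢ Icc (-δ) δ, ‖u p‖ ≤ B)
    (hD : ∀ x, ‖positiveBump (δ / 4) x‖ ≤ D) (m : ℕ) :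
    Real.exp (-m) * Real.cosh (T * (m : ℝ) ^ (s / 2)) * (∫ x, positiveBump (δ / 4) x).re ≤
      B * D * (2 * δ) := by
  set χ := positiveBump (δ / 4) with hχ
  set g : ℝ → ℂ := fun x => χ x * Complex.exp (Complex.I * (-(m : ℝ) ^ s : ℝ) * x) with hgdef
  have hg : ContDiff ℝ ∞ g := (contDiff_positiveBump _).mul (contDiff_cexp_mul_ofReal _)
  have hgs : tsupport g ⊆ Ioo (-δ) δ :=
    (tsupport_mul_subset_left).trans (tsupport_positiveBump_subset (by linarith))
  have hgc : HasCompactSupport g := (hasCompactSupport_positiveBump _).mul_right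
  -- The constant `C` depends on `m`, which is harmless: `n → ∞` is taken with `m` fixed, and `C`
  -- occurs only in the remainder.
  obtain ⟨C, hC0, hC⟩ : FactorialSqBound 36 g := by
    have := (factorialSqBound_positiveBump (δ / 4)).mul (by norm_num) (contDiff_positiveBump _)
      (contDiff_cexp_mul_ofReal _) (factorialSqBound_cexp (a := 18) (by norm_num) (-(m : ℝ) ^ s))
    norm_num only at this
    exact this
  have hsum : HasSum (fun k : ℕ => (T * (m : ℝ) ^ (s / 2)) ^ (2 * k) / (2 * k)! *
      (Real.exp (-m) * (∫ x, χ x).re))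
      (Real.cosh (T * (m : ℝ) ^ (s / 2)) * (Real.exp (-m) * (∫ x, χ x).re)) :=
    (Real.hasSum_cosh _).mul_right _
  have hlim := hsum.tendsto_sum_nat.comp (tendsto_add_atTop_nat 1)
  have hrem := (tendsto_taylor_remainder hB0 hC0 hT hT' hδ).const_add (B * D * (2 * δ))
  rw [add_zero] at hrem
  have hgoal := le_of_tendsto_of_tendsto' hlim hrem fun n => by
    have ht := h.norm_sub_taylor_le hT hδ hg hgs hB hC hv n
    have hint (k : ℕ) : ∫ x in (-δ)..δ, u (0, x) * (Complex.I ^ k * iteratedDeriv k g x) =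
        ∫ x, exponentialSeries s k x * g x := by
      rw [← integral_exponentialSeries_mul_iteratedDeriv hs hg hgc,
        ← intervalIntegral.integral_eq_integral_of_support_subset (a := -δ) (b := δ)]
      · refine intervalIntegral.integral_congr fun x hx => ?_
        rw [uIcc_of_le (by linarith)] at hx
        simp only [hu x hx]
      · intro x hx
        have hx' : iteratedDeriv k g x ≠ 0 := fun h0 => hx (by simp [h0])
        exact Ioo_subset_Ioc_self (hgs (tsupport_iteratedDeriv_real_subset g k
          (subset_tsupport _ hx')))
    simp only [hint] at ht
    have hup : ‖∫ x in (-δ)..δ, u (T, x) * g x‖ ≤ B * D * (2 * δ) := by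
      have := intervalIntegral.norm_integral_le_of_norm_le_const (a := -δ) (b := δ)
        (C := B * D) (f := fun x => u (T, x) * g x) (by
          intro x hx
          rw [uIoc_of_le (by linarith)] at hx
          rw [norm_mul, hgdef, norm_mul, norm_cexp_I_mul_ofReal, mul_one]
          exact mul_le_mul (hB (T, x) ⟨right_mem_Icc.mpr hT.le, Ioc_subset_Icc_self hx⟩) (hD x)
            (norm_nonneg _) hB0)
      rwa [show |δ - -δ| = 2 * δ by rw [abs_of_pos] <;> linarith] at this
    have hre : (∑ k ∈ Finset.range (n + 1), ((T ^ (2 * k) / (2 * k)! : ℝ) : ℂ) *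
        ∫ x, exponentialSeries s k x * g x).re ≤ B * D * (2 * δ) +
        B * (C * 36 ^ (n + 1) * ((n + 1)! : ℝ) ^ 2) * (2 * δ) * T ^ (2 * n + 2) /
          (2 * n + 1)! := by
      refine (Complex.re_le_norm _).trans ?_
      rw [norm_sub_rev] at ht
      have := norm_le_norm_add_norm_sub' (∑ k ∈ Finset.range (n + 1),
        ((T ^ (2 * k) / (2 * k)! : ℝ) : ℂ) * ∫ x, exponentialSeries s k x * g x)
        (∫ x in (-δ)..δ, u (T, x) * g x)
      linarith
    refine le_trans ?_ hre
    rw [Complex.re_sum]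
    refine Finset.sum_le_sum fun k _ => ?_
    rw [Complex.re_ofReal_mul]
    have hk := le_re_integral_exponentialSeries_mul hs (contDiff_positiveBump (δ / 4)).continuous
      (hasCompactSupport_positiveBump _) (re_integral_positiveBump_mul_cexp_nonneg (δ / 4)) k m
    have hpow : (T * (m : ℝ) ^ (s / 2)) ^ (2 * k) = T ^ (2 * k) * ((m : ℝ) ^ s) ^ k := by
      rw [mul_pow, pow_mul ((m : ℝ) ^ (s / 2)), ← Real.rpow_natCast ((m : ℝ) ^ (s / 2)),
        ← Real.rpow_mul (by positivity)]
      norm_num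
    rw [hpow]
    calc _ = T ^ (2 * k) / (2 * k)! * (Real.exp (-m) * ((m : ℝ) ^ s) ^ k * (∫ x, χ x).re) := by
          ring
      _ ≤ _ := mul_le_mul_of_nonneg_left hk (by positivity)
  calc _ = Real.cosh (T * (m : ℝ) ^ (s / 2)) * (Real.exp (-m) * (∫ x, χ x).re) := by ring
    _ ≤ _ := hgoal

theorem not_isRectangleSolution {s T δ : ℝ} (hs : 2 < s) (hT : 0 < T) (hδ : 0 < δ)
    {u v w z : ℝ × ℝ → ℂ} (hu : ∀ x ∈ Icc (-δ) δ, u (0, x) = exponentialSeries s 0 x)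
    (hv : ∀ x ∈ Icc (-δ) δ, v (0, x) = 0) : ¬ IsRectangleSolution T δ u v w z := by
  intro h
  -- The time is shortened so that the Taylor remainder with rate `36` tends to zero.
  have hT0 : 0 < min T (1 / 10) := lt_min hT (by norm_num)
  have h' := h.mono (min_le_left T (1 / 10))
  obtain ⟨B, hB⟩ := (isCompact_Icc.prod isCompact_Icc).exists_bound_of_continuousOn
    h'.continuousOn_u
  obtain ⟨D, hD⟩ := (contDiff_positiveBump (δ / 4)).continuous.bounded_above_of_compact_support
    (hasCompactSupport_positiveBump _)
  have hB0 : 0 ≤ B := (norm_nonneg _).trans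
    (hB (0, 0) ⟨left_mem_Icc.mpr hT0.le, by constructor <;> simp [hδ.le]⟩)
  have htop := (tendsto_exp_neg_mul_cosh hs hT0).atTop_mul_const
    (re_integral_positiveBump_pos (r := δ / 4) (by linarith))
  obtain ⟨m, hm⟩ := (htop.eventually_gt_atTop (B * D * (2 * δ))).exists
  exact absurd (h'.exp_neg_mul_cosh_le (by linarith) hT0 (min_le_right _ _) hδ hu hv hB0 hB hD m)
    (not_le.mpr hm)

/-! ### From smooth solutions to solutions on a rectangle. -/

theorem hasDerivWithinAt_slice_left {f : ℝ × ℝ → ℂ} {S : Set (ℝ × ℝ)} {J : Set ℝ} {t x : ℝ}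
    (hf : DifferentiableOn ℝ f S) (hJ : ∀ τ ∈ J, (τ, x) ∈ S) (ht : (t, x) ∈ S) :
    HasDerivWithinAt (fun τ => f (τ, x)) (fderivWithin ℝ f S (t, x) (1, 0)) J t :=
  (hf _ ht).hasFDerivWithinAt.comp_hasDerivWithinAt t
    ((hasDerivWithinAt_id t J).prodMk (hasDerivWithinAt_const t J x)) hJ

theorem hasDerivWithinAt_slice_right {f : ℝ × ℝ → ℂ} {S : Set (ℝ × ℝ)} {J : Set ℝ} {t x : ℝ}
    (hf : DifferentiableOn ℝ f S) (hJ : ∀ y ∈ J, (t, y) ∈ S) (hx : (t, x) ∈ S) :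
    HasDerivWithinAt (fun y => f (t, y)) (fderivWithin ℝ f S (t, x) (0, 1)) J x :=
  (hf _ hx).hasFDerivWithinAt.comp_hasDerivWithinAt x
    ((hasDerivWithinAt_const x J t).prodMk (hasDerivWithinAt_id x J)) hJ

theorem contDiffOn_fderivWithin_apply_const {f : ℝ × ℝ → ℂ} {S : Set (ℝ × ℝ)}
    (hS : UniqueDiffOn ℝ S) (hf : ContDiffOn ℝ ∞ f S) (e : ℝ × ℝ) :
    ContDiffOn ℝ ∞ (fun p => fderivWithin ℝ f S p e) S :=
  (hf.fderivWithin hS (by simp)).clm_apply contDiffOn_const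

/-- Stated for any set of unique differentiability, so that it covers both an open neighborhood and
the closed strip. -/
theorem isRectangleSolution_of_contDiffOn {T δ : ℝ} {u : ℝ × ℝ → ℂ} {S : Set (ℝ × ℝ)}
    (hS : UniqueDiffOn ℝ S) (hu : ContDiffOn ℝ ∞ u S) (hsub : Icc 0 T ×ˢ Icc (-δ) δ ⊆ S)
    (heq : ∀ t ∈ Icc 0 T, ∀ x ∈ Icc (-δ) δ,
      fderivWithin ℝ (fun p => fderivWithin ℝ u S p (1, 0)) S (t, x) (1, 0) +
        Complex.I * fderivWithin ℝ u S (t, x) (0, 1) = 0) :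
    IsRectangleSolution T δ u (fun p => fderivWithin ℝ u S p (1, 0))
      (fun p => fderivWithin ℝ (fun p => fderivWithin ℝ u S p (1, 0)) S p (1, 0))
      (fun p => fderivWithin ℝ u S p (0, 1)) := by
  have hv := contDiffOn_fderivWithin_apply_const hS hu (1, 0)
  exact
    { continuousOn_u := hu.continuousOn.mono hsub
      continuousOn_v := hv.continuousOn.mono hsub
      continuousOn_w := (contDiffOn_fderivWithin_apply_const hS hv (1, 0)).continuousOn.mono hsub
      continuousOn_z := (contDiffOn_fderivWithin_apply_const hS hu (0, 1)).continuousOn.mono hsub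
      hasDeriv_u := fun t ht x hx => hasDerivWithinAt_slice_left (hu.differentiableOn (by simp))
        (fun τ hτ => hsub ⟨hτ, hx⟩) (hsub ⟨ht, hx⟩)
      hasDeriv_v := fun t ht x hx => hasDerivWithinAt_slice_left (hv.differentiableOn (by simp))
        (fun τ hτ => hsub ⟨hτ, hx⟩) (hsub ⟨ht, hx⟩)
      hasDeriv_x := fun t ht x hx => hasDerivWithinAt_slice_right (hu.differentiableOn (by simp))
        (fun y hy => hsub ⟨ht, hy⟩) (hsub ⟨ht, hx⟩)
      equation := heq }

theorem hasDerivAt_slice_left {f : ℝ × ℝ → ℂ} {U : Set (ℝ × ℝ)} (hU : IsOpen U) {t x : ℝ}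
    (hf : DifferentiableOn ℝ f U) (ht : (t, x) ∈ U) :
    HasDerivAt (fun τ => f (τ, x)) (fderivWithin ℝ f U (t, x) (1, 0)) t :=
  (hasDerivWithinAt_slice_left (J := {τ | (τ, x) ∈ U}) hf (fun _ h => h) ht).hasDerivAt
    ((hU.preimage (by fun_prop : Continuous fun τ : ℝ => (τ, x))).mem_nhds ht)

theorem hasDerivAt_slice_right {f : ℝ × ℝ → ℂ} {U : Set (ℝ × ℝ)} (hU : IsOpen U) {t x : ℝ}
    (hf : DifferentiableOn ℝ f U) (hx : (t, x) ∈ U) :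
    HasDerivAt (fun y => f (t, y)) (fderivWithin ℝ f U (t, x) (0, 1)) x :=
  (hasDerivWithinAt_slice_right (J := {y | (t, y) ∈ U}) hf (fun _ h => h) hx).hasDerivAt
    ((hU.preimage (by fun_prop : Continuous fun y : ℝ => (t, y))).mem_nhds hx)

theorem not_locallySolvableAtOrigin {s : ℝ} (hs : 2 < s) {A : Set (ℝ → ℂ)}
    (hA : exponentialSeries s 0 ∈ A) (h0 : (fun _ => 0) ∈ A) :
    ¬ LocallySolvableAtOrigin modelOperator A := by
  intro h
  obtain ⟨U, hU, hU0, u, hu, heq, hdata⟩ := h _ hA _ h0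
  obtain ⟨ε, hε, hball⟩ := Metric.isOpen_iff.mp hU _ hU0
  have hsub : Icc 0 (ε / 2) ×ˢ Icc (-(ε / 2)) (ε / 2) ⊆ U := by
    rintro ⟨t, x⟩ ⟨ht, hx⟩
    apply hball
    rw [Metric.mem_ball, Prod.dist_eq, max_lt_iff, Real.dist_eq, Real.dist_eq, sub_zero, sub_zero,
      abs_lt, abs_lt]
    exact ⟨⟨by linarith [ht.1], by linarith [ht.2]⟩, by linarith [hx.1], by linarith [hx.2]⟩
  have hd := hu.differentiableOn (by simp : (∞ : ℕ∞ω) ≠ 0)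
  have hdv := (contDiffOn_fderivWithin_apply_const hU.uniqueDiffOn hu (1, 0)).differentiableOn
    (by simp : (∞ : ℕ∞ω) ≠ 0)
  have hmem : ∀ x ∈ Icc (-(ε / 2)) (ε / 2), ((0 : ℝ), x) ∈ U := fun x hx =>
    hsub ⟨left_mem_Icc.mpr (by linarith), hx⟩
  refine not_isRectangleSolution hs (half_pos hε) (half_pos hε)
    (fun x hx => (hdata x (hmem x hx)).1) (fun x hx => ?_)
    (isRectangleSolution_of_contDiffOn hU.uniqueDiffOn hu hsub fun t ht x hx => ?_)
  · rw [← (hasDerivAt_slice_left hU hd (hmem x hx)).deriv]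
    exact (hdata x (hmem x hx)).2
  · have hp := hsub (mk_mem_prod ht hx)
    have h1 := heq _ hp
    -- The first derivatives must agree on a whole neighborhood of `t`, as they are differentiated
    -- once more.
    have h2 : deriv (fun τ => u (τ, x)) =ᶠ[𝓝 t] fun τ => fderivWithin ℝ u U (τ, x) (1, 0) := by
      filter_upwards [(hU.preimage (by fun_prop : Continuous fun τ : ℝ => (τ, x))).mem_nhds hp]
        with τ hτ using (hasDerivAt_slice_left hU hd hτ).deriv
    rw [modelOperator, iteratedDeriv_succ, iteratedDeriv_one, h2.deriv_eq,
      (hasDerivAt_slice_left hU hdv hp).deriv, (hasDerivAt_slice_right hU hd hp).deriv] at h1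
    exact h1

theorem zero_mem_gevreyClass (s : ℝ) : (fun _ => 0) ∈ gevreyClass s := by
  refine ⟨contDiff_const, fun K _ => ⟨1, 1, one_pos, one_pos, fun x _ k => ?_⟩⟩
  have h0 : iteratedDeriv k (fun _ : ℝ => (0 : ℂ)) x = 0 := iteratedDeriv_const_zero
  rw [h0, norm_zero]
  positivity

theorem not_smoothlySolvableOnStrip {T : ℝ} (hT : 0 < T) : ¬ SmoothlySolvableOnStrip T := by
  intro h
  -- Any order above `2` would serve in place of `3`; only the smoothness of the datum is used.
  obtain ⟨u, hu, heq, hdata⟩ := h _ (exponentialSeries_mem_gevreyClass (s := 3) (by norm_num)).1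
    (fun _ => 0) (zero_mem_gevreyClass 0).1
  have hI : UniqueDiffOn ℝ (Icc 0 T) := uniqueDiffOn_Icc hT
  have hS : UniqueDiffOn ℝ (Icc 0 T ×ˢ (univ : Set ℝ)) := hI.prod uniqueDiffOn_univ
  have hd := hu.differentiableOn (by simp : (∞ : ℕ∞ω) ≠ 0)
  have hdv := (contDiffOn_fderivWithin_apply_const hS hu (1, 0)).differentiableOn
    (by simp : (∞ : ℕ∞ω) ≠ 0)
  have hut (x : ℝ) : ∀ t ∈ Icc 0 T, derivWithin (fun τ => u (τ, x)) (Icc 0 T) t =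
      fderivWithin ℝ u (Icc 0 T ×ˢ univ) (t, x) (1, 0) := fun t ht =>
    (hasDerivWithinAt_slice_left hd (fun τ hτ => ⟨hτ, mem_univ x⟩)
      ⟨ht, mem_univ x⟩).derivWithin (hI t ht)
  refine not_isRectangleSolution (s := 3) (by norm_num) hT one_pos
    (fun x _ => (hdata x).1) (fun x _ => ?_)
    (isRectangleSolution_of_contDiffOn hS hu (prod_mono_right (subset_univ _)) fun t ht x _ => ?_)
  · rw [← hut x 0 (left_mem_Icc.mpr hT.le)]
    exact (hdata x).2
  · have h1 := heq t ht x
    rw [iteratedDerivWithin_succ, iteratedDerivWithin_one,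
      derivWithin_congr (hut x) (hut x t ht),
      (hasDerivWithinAt_slice_left hdv (fun τ hτ => ⟨hτ, mem_univ x⟩)
        ⟨ht, mem_univ x⟩).derivWithin (hI t ht),
      (hasDerivWithinAt_slice_right (J := univ) hd (fun y _ => ⟨ht, mem_univ y⟩)
        ⟨ht, mem_univ x⟩).hasDerivAt univ_mem |>.deriv] at h1
    exact h1

theorem mainTheorem3 :
    (∀ s : ℝ, 2 < s → ¬ LocallySolvableAtOrigin modelOperator (gevreyClass s)) ∧
    ¬ LocallySolvableAtOrigin modelOperator smoothClass ∧
    (∀ T : ℝ, 0 < T → ¬ SmoothlySolvableOnStrip T) :=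
  ⟨fun s hs => not_locallySolvableAtOrigin hs (exponentialSeries_mem_gevreyClass (by linarith))
      (zero_mem_gevreyClass s),
    not_locallySolvableAtOrigin (s := 3) (by norm_num)
      (exponentialSeries_mem_gevreyClass (by norm_num)).1 (zero_mem_gevreyClass 0).1,
    fun _ hT => not_smoothlySolvableOnStrip hT⟩
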